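/- **Setting.** Let $d,d'\ge 0$, let $\operatorname{dom}X=\{s=(s^0,\dots,s^d)\in\mathbb R^{d+1}: s^0>0\}$ and $X(s)=(s^1/s^0,\dots,s^d/s^0)$, and let $\operatorname{dom}X'\subset\mathbb R^{d'+1}$ and $X'$ be the same objects in dimension $d'$. A *trajectory* is a triple $\mathbf S=(S,W,m)$ of a sequence of prices $S_i\in\mathbb R^{d+1}$, a sequence of further observables $W_i\in\Omega_i$ (arbitrary sets) and $m\in\mathbb N$; put $\mathbf S_i=(S_i,W_i,m)$ and $M(\mathbf S)=m$. A *market* (with $d+1$ assets) $\mathcal M=\mathcal S\times\mathcal H$ consists of a set $\mathcal S$ of trajectories with $S_i\in\Sigma_i$, $m\in\Theta$ (for given sets $\Sigma_i\subseteq\mathbb R^{d+1}$, $\Theta\subseteq\mathbb N$), with common initial value $(S_0,W_0)=(s_0,w_0)$ and with $S^0_i>0$ for all $i\ge0$, and of a set $\mathcal H$ of non-anticipative self-financing portfolios on $\mathcal S$, each of which vanishes from some stage (depending on the trajectory) on, that contains the null portfolio. For a node $(\mathbf S,k)$ with $\mathbf S\in\mathcal S$ and $k\ge 0$ let $$\mathcal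 S_{(\mathbf S,k)}=\{\mathbf S'\in\mathcal S:\ \mathbf S'_i=\mathbf S_i\ (0\le i\le k),\ M(\mathbf S')>k\}.$$ The node is *arbitrage-free* if $0\in\operatorname{ri}\big(\operatorname{co}\{X(S'_{k+1})-X(S'_k):\mathbf S'\in\mathcal S_{(\mathbf S,k)}\}\big)$, where $\operatorname{co}$ is the convex hull and $\operatorname{ri}$ the relative interior. A map $f:\operatorname{dom}X\to\operatorname{dom}X'$ *transforms* $\mathcal M$ onto a market $\mathcal M'=\mathcal S'\times\mathcal H'$ with $d'+1$ assets by means of a surjection $T:\mathcal S\to\mathcal S'$ if the prices of $T\mathbf S$ are $f(S_i)$, $i\ge 0$, and the remaining components of $T\mathbf S$ are prescribed in any way for which nodes go to nodes, i.e. $\mathcal S'_{(T\mathbf S,k)}=T(\mathcal S_{(\mathbf S,k)})$ for all $\mathbf S\in\mathcal S$, $k\ge 0$. The map $f$ is a *no-arbitrage symmetry for every market* if, for all such $\mathcal M,\mathcal M',T$ and every arbitrage-free node $(\mathbf S,k)$ of $\mathcal M$, the node $(T\mathbf S,k)$ of $\mathcal M'$ is arbitrage-free. A map $g$ from $\operatorname{dom}X$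 to a real vector space satisfies the *scaling condition* if for all $s\in\operatorname{dom}X$ and $\lambda>0$ there is $\mu>0$ (depending on $\lambda$ and $s$) with $g(\lambda s)=\mu\,g(s)$. We say that $f$ is of *fractional form* if its first coordinate $f^0$ satisfies the scaling condition and there is a linear map $L:\mathbb R^{d+1}\to\mathbb R^{d'+1}$, with first coordinate $L^0$, such that $f^0>0$ and $L^0>0$ on $\{s^0>0\}$ and $$f(s)=\frac{f^0(s)}{L^0(s)}\,L(s)\qquad\text{for all } s\in\operatorname{dom}X .$$ **Corollary (Explicit Characterization).** Let $f:\operatorname{dom}X\to\operatorname{dom}X'$ satisfy the scaling condition. 1. If $f$ is a no-arbitrage symmetry for every market and $\operatorname{Im}f$ is not contained in a $2$-dimensional linear subspace of $\mathbb R^{d'+1}$, then $f$ is of fractional form. 2. Conversely, if $f$ is of fractional form, then $f$ is a no-arbitrage symmetry for every market. -/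

import Mathlib

universe u

/-- The coordinate space `ℝⁿ` with its Euclidean structure. -/
abbrev Vec (n : ℕ) : Type := EuclideanSpace ℝ (Fin n)

/-- The domain `{s ∈ ℝ^{d+1} : s⁰ > 0}` of the perspective function. -/
abbrev PerspDom (d : ℕ) : Type := {s : Vec (d + 1) // 0 < s 0}

/-- The perspective function `X(s) = (s¹/s⁰, …, s^d/s⁰)`; it is only used where `s⁰ > 0`. -/
noncomputable def persp {d : ℕ} (s : Vec (d + 1)) : Vec d :=
  WithLp.toLp 2 fun j => s j.succ / s 0

/-- The point `c s` of the domain, for `c > 0`. -/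
def PerspDom.scale {d : ℕ} (c : ℝ) (hc : 0 < c) (s : PerspDom d) : PerspDom d :=
  ⟨c • s.1, mul_pos hc s.2⟩

/-- For all `s` and `c > 0` there is `μ > 0` with `g (c s) = μ g(s)`. -/
def ScalarCondition {d : ℕ} {V : Type*} [AddCommGroup V] [Module ℝ V]
    (g : PerspDom d → V) : Prop :=
  ∀ (c : ℝ) (hc : 0 < c) (s : PerspDom d), ∃ μ : ℝ, 0 < μ ∧ g (s.scale c hc) = μ • g s

/-- The data `(S, W, m)` of a trajectory with `d + 1` assets: prices `S i`, further observables
`W i ∈ Ω i`, and the stage `m`. -/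
structure Trajectory (d : ℕ) (Ω : ℕ → Type u) where
  price : ℕ → Vec (d + 1)
  obs : (i : ℕ) → Ω i
  stage : ℕ

/-- The `i`-th term `(S_i, W_i, m)` of a trajectory. -/
def Trajectory.term {d : ℕ} {Ω : ℕ → Type u} (S : Trajectory d Ω) (i : ℕ) :
    Vec (d + 1) × Ω i × ℕ :=
  (S.price i, S.obs i, S.stage)

/-- All trajectories that start at `(s₀, w₀)`, with `S_i ∈ Sig i` and `m ∈ Θ`. -/
def trajectorySpace {d : ℕ} {Ω : ℕ → Type u} (Sig : ℕ → Set (Vec (d + 1))) (Θ : Set ℕ)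
    (s₀ : Vec (d + 1)) (w₀ : Ω 0) : Set (Trajectory d Ω) :=
  {S | (∀ i, S.price i ∈ Sig i) ∧ S.stage ∈ Θ ∧ S.price 0 = s₀ ∧ S.obs 0 = w₀}

/-- A (non-anticipative) portfolio `Φ = (H⁰, H)` on a set of trajectories. -/
structure Portfolio {d : ℕ} {Ω : ℕ → Type u} (𝒮 : Set (Trajectory d Ω)) where
  hold0 : ℕ → 𝒮 → ℝ
  hold : ℕ → 𝒮 → Vec d
  nonanticipative : ∀ (S S' : 𝒮) (k : ℕ), k < min S.1.stage S'.1.stage →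
    (∀ i ≤ k, S'.1.term i = S.1.term i) → hold0 k S = hold0 k S' ∧ hold k S = hold k S'

/-- The value `H⁰_i S⁰_j + H_i · S_j` of the holdings of stage `i` at the prices of stage `j`. -/
def Portfolio.value {d : ℕ} {Ω : ℕ → Type u} {𝒮 : Set (Trajectory d Ω)} (Φ : Portfolio 𝒮)
    (S : 𝒮) (i j : ℕ) : ℝ :=
  Φ.hold0 i S * S.1.price j 0 + ∑ l : Fin d, Φ.hold i S l * S.1.price j l.succ

def Portfolio.SelfFinancing {d : ℕ} {Ω : ℕ → Type u} {𝒮 : Set (Trajectory d Ω)}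
    (Φ : Portfolio 𝒮) : Prop :=
  ∀ (S : 𝒮) (i : ℕ), Φ.value S i (i + 1) = Φ.value S (i + 1) (i + 1)

/-- The null portfolio. -/
def Portfolio.null {d : ℕ} {Ω : ℕ → Type u} (𝒮 : Set (Trajectory d Ω)) : Portfolio 𝒮 where
  hold0 := fun _ _ => 0
  hold := fun _ _ => 0
  nonanticipative := fun _ _ _ _ _ => ⟨rfl, rfl⟩

/-- A trajectory based market `ℳ = 𝒮 × ℋ` with `d + 1` assets, the asset `0` having positive
price along every trajectory, and with an admissible portfolio set `ℋ`. -/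
structure Market (d : ℕ) where
  Ω : ℕ → Type u
  Sig : ℕ → Set (Vec (d + 1))
  Θ : Set ℕ
  s₀ : Vec (d + 1)
  w₀ : Ω 0
  paths : Set (Trajectory d Ω)
  paths_subset : paths ⊆ trajectorySpace Sig Θ s₀ w₀
  price_pos : ∀ S : paths, ∀ i, 0 < S.1.price i 0
  portfolios : Set (Portfolio paths)
  selfFinancing : ∀ Φ ∈ portfolios, Φ.SelfFinancing
  null_mem : Portfolio.null paths ∈ portfolios
  liquidated : ∀ Φ ∈ portfolios, ∀ S : paths, ∃ N : ℕ, ∀ k ≥ N, Φ.hold0 k S = 0 ∧ Φ.hold k S = 0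

namespace Market

/-- The price vector `S_i` as a point of the domain of the perspective function. -/
def pricePt {d : ℕ} (M : Market.{u} d) (S : M.paths) (i : ℕ) : PerspDom d :=
  ⟨S.1.price i, M.price_pos S i⟩

/-- The trajectory set `𝒮_{(S,k)}` conditioned at the node `(S, k)`. -/
def conditioned {d : ℕ} (M : Market.{u} d) (S : M.paths) (k : ℕ) : Set M.paths :=
  {S' | (∀ i ≤ k, S'.1.term i = S.1.term i) ∧ k < S'.1.stage}

/-- The set `ΔX(𝒮_{(S,k)}) = {X(S'_{k+1}) - X(S'_k) : S' ∈ 𝒮_{(S,k)}}`. -/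
def increments {d : ℕ} (M : Market.{u} d) (S : M.paths) (k : ℕ) : Set (Vec d) :=
  (fun S' : M.paths => persp (S'.1.price (k + 1)) - persp (S'.1.price k)) '' M.conditioned S k

/-- The node `(S, k)` is arbitrage-free: `0 ∈ ri (co (ΔX(𝒮_{(S,k)})))`. -/
def ArbitrageFreeNode {d : ℕ} (M : Market.{u} d) (S : M.paths) (k : ℕ) : Prop :=
  (0 : Vec d) ∈ intrinsicInterior ℝ (convexHull ℝ (M.increments S k))

end Market

/-- `T` transforms the market `M` onto the market `M'` through `f`: the price component of `T S`
is `f(S_k)`, `k ≥ 0`; the other components `W', m'` are prescribed in any way for which the node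
`(S, k)` becomes the node `(T S, k)`, that is, the trajectories of `M'` through `(T S, k)` are the
transforms of the trajectories of `M` through `(S, k)`. -/
structure IsTransformation {d d' : ℕ} (f : PerspDom d → PerspDom d') (M : Market.{u} d)
    (M' : Market.{u} d') (T : M.paths → M'.paths) : Prop where
  onto : Function.Surjective T
  price_eq : ∀ (S : M.paths) (k : ℕ), M'.pricePt (T S) k = f (M.pricePt S k)
  node_eq : ∀ (S : M.paths) (k : ℕ), M'.conditioned (T S) k = T '' M.conditioned S k

/-- `f` is a no-arbitrage symmetry for every market: whatever the market and its transform,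
arbitrage-free nodes are transformed into arbitrage-free nodes. -/
def IsNoArbitrageSymmetry {d d' : ℕ} (f : PerspDom d → PerspDom d') : Prop :=
  ∀ (M : Market.{u} d) (M' : Market.{u} d') (T : M.paths → M'.paths),
    IsTransformation f M M' T →
      ∀ (S : M.paths) (k : ℕ), M.ArbitrageFreeNode S k → M'.ArbitrageFreeNode (T S) k

/-- `f(s) = (f⁰(s) / L⁰(s)) L(s)` where `L` is linear, `f⁰, L⁰ > 0` on `s⁰ > 0`, and `f⁰` has the
scaling property. -/
def HasFractionalForm {d d' : ℕ} (f : PerspDom d → PerspDom d') : Prop :=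
  ScalarCondition (fun s => (f s).1 0) ∧
  ∃ L : Vec (d + 1) →ₗ[ℝ] Vec (d' + 1),
    (∀ s : PerspDom d, 0 < (f s).1 0 ∧ 0 < L s.1 0) ∧
    ∀ s : PerspDom d, (f s).1 = ((f s).1 0 / L s.1 0) • L s.1

/-!
The scaling condition makes `f` induce a map `F` of relative prices, `X'(f s) = F (X s)`, defined
on the whole of `ℝ^d`, and both sides of the equivalence are statements about `F`: fractional form
means that `F` is affine, because a linear form that is positive on the whole half-space
`s⁰ > 0` is a multiple of `s⁰`.

*Affine maps are symmetries.* The increments of the transformed market at a node are the image of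
the original increments under the linear part of `F`, and linear maps carry `0 ∈ ri (co D)` over
to the image of `D`. The latter follows from the description of the relative interior by
prolongation of segments, `Convex.zero_mem_intrinsicInterior_iff`.

*Symmetries are affine.* A one-step market with the two possible increments `a - x` and `b - x`
has an arbitrage-free initial node iff `x` lies in the open segment from `a` to `b`. So `F`
preserves open segments (`IsNoArbitrageSymmetry.mapsTo_openSegment`). By the dimension
hypothesis, `F` is constant or its range is not contained in a line.

Such an `F` is affine (`exists_linearMap_of_mapsTo_openSegment`). Fix a point `z` and let the
weight `g p > 0` describe the position of the image of the midpoint of `z` and `p`: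
`(1 + g p) F(midpoint z p) = F z + g p F p`. If `F z, F p, F q` form a triangle, Ceva's theorem
applied to the images of the medians of `z p q` shows that the same weights locate the image of
the midpoint of `p` and `q`. Comparing
`midpoint z (midpoint p q) = midpoint (midpoint z p) (midpoint z q)` then gives Jensen's equation
`2 g (midpoint p q) = g p + g q`. Hence `g` runs through an arithmetic progression along
`p, q, 2 q - p, …`; being positive on the unbounded half-line it cannot decrease, and by symmetry
`g p = g q`. So `F` maps midpoints to midpoints, and boundedness on segments makes it affine.
-/

/-! ### Relative interiors -/

theorem mem_intrinsicInterior_iff_exists_dist_lt {E : Type*} [NormedAddCommGroup E]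
    [NormedSpace ℝ E] {C : Set E} {x : E} :
    x ∈ intrinsicInterior ℝ C ↔ x ∈ affineSpan ℝ C ∧
      ∃ r > 0, ∀ z ∈ affineSpan ℝ C, dist z x < r → z ∈ C := by
  rw [mem_intrinsicInterior]
  constructor
  · rintro ⟨y, hy, rfl⟩
    obtain ⟨r, hr, h⟩ := Metric.mem_nhds_iff.1 (mem_interior_iff_mem_nhds.1 hy)
    exact ⟨y.2, r, hr, fun z hz hd => @h ⟨z, hz⟩ hd⟩
  · rintro ⟨hx, r, hr, h⟩
    refine ⟨⟨x, hx⟩, mem_interior_iff_mem_nhds.2 (Metric.mem_nhds_iff.2 ⟨r, hr, ?_⟩), rfl⟩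
    exact fun z hz => h z z.2 hz

/-- A convex set has the origin in its relative interior iff every segment from a point of the
set to the origin can be prolonged within the set. -/
theorem Convex.zero_mem_intrinsicInterior_iff {E : Type*} [NormedAddCommGroup E]
    [NormedSpace ℝ E] [FiniteDimensional ℝ E] {C : Set E} (hC : Convex ℝ C) :
    (0 : E) ∈ intrinsicInterior ℝ C ↔ (0 : E) ∈ C ∧ ∀ x ∈ C, ∃ ε : ℝ, 0 < ε ∧ -ε • x ∈ C := by
  constructor
  · intro h
    refine ⟨intrinsicInterior_subset h, fun x hx => ?_⟩
    obtain ⟨h0, r, hr, hb⟩ := mem_intrinsicInterior_iff_exists_dist_lt.1 h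
    have hn : 0 < ‖x‖ + 1 := by positivity
    refine ⟨r / (‖x‖ + 1), by positivity, hb _ ?_ ?_⟩
    · have := AffineMap.lineMap_mem (-(r / (‖x‖ + 1))) h0 (subset_affineSpan ℝ C hx)
      simpa [AffineMap.lineMap_apply] using this
    · rw [dist_zero_right, norm_smul, norm_neg, Real.norm_of_nonneg (by positivity),
        div_mul_eq_mul_div, div_lt_iff₀ hn]
      nlinarith
  · rintro ⟨h0, h⟩
    obtain ⟨y, hy⟩ := Set.Nonempty.intrinsicInterior hC ⟨0, h0⟩
    obtain ⟨ε, hε, hyε⟩ := h y (intrinsicInterior_subset hy)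
    obtain ⟨hyA, r, hr, hb⟩ := mem_intrinsicInterior_iff_exists_dist_lt.1 hy
    have h0A := subset_affineSpan ℝ C h0
    refine mem_intrinsicInterior_iff_exists_dist_lt.2 ⟨h0A, r * (ε / (1 + ε)), by positivity, ?_⟩
    intro w hw hd
    -- `0` is a convex combination of `y` and `-ε y`; a small shift `w` of it is obtained from
    -- the same combination by shifting `y` alone.
    have hz : y + ((1 + ε) / ε) • w ∈ C := by
      refine hb _ ?_ ?_
      · have := AffineSubspace.smul_vsub_vadd_mem (affineSpan ℝ C) ((1 + ε) / ε) hw h0A hyA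
        simpa [add_comm] using this
      · rw [dist_zero_right] at hd
        rw [dist_self_add_left, norm_smul, Real.norm_of_nonneg (by positivity)]
        calc (1 + ε) / ε * ‖w‖ < (1 + ε) / ε * (r * (ε / (1 + ε))) := by gcongr
          _ = r := by field_simp
    have := hC hz hyε (a := ε / (1 + ε)) (b := 1 / (1 + ε)) (by positivity) (by positivity)
      (by field_simp; ring)
    convert this using 1
    rw [smul_add, smul_smul, smul_smul, add_right_comm, ← add_smul]
    have e1 : ε / (1 + ε) + 1 / (1 + ε) * -ε = 0 := by field_simp; ring
    have e2 : ε / (1 + ε) * ((1 + ε) / ε) = 1 := by field_simp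
    rw [e1, e2, zero_smul, zero_add, one_smul]

theorem zero_mem_intrinsicInterior_convexHull_image {E G : Type*} [NormedAddCommGroup E]
    [NormedSpace ℝ E] [FiniteDimensional ℝ E] [NormedAddCommGroup G] [NormedSpace ℝ G]
    [FiniteDimensional ℝ G] (A : E →ₗ[ℝ] G) {s : Set E}
    (h : (0 : E) ∈ intrinsicInterior ℝ (convexHull ℝ s)) :
    (0 : G) ∈ intrinsicInterior ℝ (convexHull ℝ (A '' s)) := by
  rw [(convex_convexHull ℝ _).zero_mem_intrinsicInterior_iff] at h ⊢
  rw [← A.image_convexHull]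
  refine ⟨⟨0, h.1, map_zero A⟩, ?_⟩
  rintro _ ⟨x, hx, rfl⟩
  obtain ⟨ε, hε, hxε⟩ := h.2 x hx
  exact ⟨ε, hε, _, hxε, map_smul A _ _⟩

theorem zero_mem_intrinsicInterior_segment_iff {E : Type*} [NormedAddCommGroup E]
    [NormedSpace ℝ E] [FiniteDimensional ℝ E] {u v : E} :
    (0 : E) ∈ intrinsicInterior ℝ (segment ℝ u v) ↔ (0 : E) ∈ openSegment ℝ u v := by
  rw [(convex_segment u v).zero_mem_intrinsicInterior_iff]
  constructor
  · rintro ⟨-, h⟩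
    obtain ⟨ε, hε, a, b, ha, hb, -, h1⟩ := h u (left_mem_segment ℝ u v)
    obtain ⟨δ, hδ, c, e, hc, he, -, h2⟩ := h v (right_mem_segment ℝ u v)
    have hs : 0 < a + ε + c + (b + e + δ) := by positivity
    refine ⟨(a + ε + c) / (a + ε + c + (b + e + δ)), (b + e + δ) / (a + ε + c + (b + e + δ)),
      by positivity, by positivity, by field_simp, ?_⟩
    have h3 : (a + ε + c) • u + (b + e + δ) • v = 0 := by
      linear_combination (norm := module) h1 + h2
    rw [div_eq_inv_mul, div_eq_inv_mul, mul_smul, mul_smul, ← smul_add, h3, smul_zero]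
  · rintro ⟨a, b, ha, hb, hab, h⟩
    refine ⟨⟨a, b, ha.le, hb.le, hab, h⟩, ?_⟩
    rintro _ ⟨c, e, hc, he, hce, rfl⟩
    have hm : 0 < min a b := lt_min ha hb
    have h1 : min a b * c ≤ a := by nlinarith [min_le_left a b]
    have h2 : min a b * e ≤ b := by nlinarith [min_le_right a b]
    refine ⟨min a b, hm, (1 + min a b) * a - min a b * c, (1 + min a b) * b - min a b * e,
      by nlinarith, by nlinarith, by linear_combination (1 + min a b) * hab - min a b * hce, ?_⟩
    linear_combination (norm := module) (1 + min a b) • h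

/-! ### Maps between real vector spaces that preserve open segments -/

/-- Affine independence of three points, in terms of the coefficients of an affine relation. -/
def NonCollinearTriple {G : Type*} [AddCommGroup G] [Module ℝ G] (X Y Z : G) : Prop :=
  ∀ a b c : ℝ, a + b + c = 0 → a • X + b • Y + c • Z = 0 → a = 0 ∧ b = 0 ∧ c = 0

section

variable {E G : Type*} [AddCommGroup E] [Module ℝ E] [AddCommGroup G] [Module ℝ G]

theorem NonCollinearTriple.coeff_eq {X Y Z : G} (h : NonCollinearTriple X Y Z)
    {a b c a' b' c' : ℝ} (hs : a + b + c = a' + b' + c')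
    (he : a • X + b • Y + c • Z = a' • X + b' • Y + c' • Z) : a = a' ∧ b = b' ∧ c = c' := by
  have := h (a - a') (b - b') (c - c') (by linear_combination hs)
    (by linear_combination (norm := module) he)
  exact ⟨by linarith [this.1], by linarith [this.2.1], by linarith [this.2.2]⟩

theorem NonCollinearTriple.swap_right {X Y Z : G} (h : NonCollinearTriple X Y Z) :
    NonCollinearTriple X Z Y := fun a b c hs he => by
  have := h a c b (by linarith) (by rw [← he]; abel)
  exact ⟨this.1, this.2.2, this.2.1⟩

/-- Replacing two vertices `Y, Z` of a triangle `X Y Z` by inner points of the sides `XY` and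
`XZ` gives a triangle. -/
theorem NonCollinearTriple.of_smul_eq {X Y Z Y' Z' : G} (h : NonCollinearTriple X Y Z) {g k : ℝ}
    (hg : 0 < g) (hk : 0 < k) (hY : (1 + g) • Y' = X + g • Y) (hZ : (1 + k) • Z' = X + k • Z) :
    NonCollinearTriple X Y' Z' := by
  intro a b c hs he
  have e : (a * (1 + g) * (1 + k) + b * (1 + k) + c * (1 + g)) • X + (b * (1 + k) * g) • Y
      + (c * (1 + g) * k) • Z = 0 := by
    linear_combination (norm := module) ((1 + g) * (1 + k)) • he - (b * (1 + k)) • hY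
      - (c * (1 + g)) • hZ
  obtain ⟨-, h2, h3⟩ := h _ _ _ (by linear_combination (1 + g) * (1 + k) * hs) e
  have hb : b = 0 := by
    have : (1 + k) * g ≠ 0 := by positivity
    exact (mul_eq_zero.1 ((mul_assoc b (1 + k) g).symm.trans h2)).resolve_right this
  have hc : c = 0 := by
    have : (1 + g) * k ≠ 0 := by positivity
    exact (mul_eq_zero.1 ((mul_assoc c (1 + g) k).symm.trans h3)).resolve_right this
  exact ⟨by linarith, hb, hc⟩

/-- The ratio in which a segment-preserving map divides the image of the midpoint of `z` and `p`,
expressed by a weight of `p` relative to the weight `1` of `z`. -/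
theorem exists_midpoint_weight {F : E → G}
    (hF : ∀ x y, Set.MapsTo F (openSegment ℝ x y) (openSegment ℝ (F x) (F y))) (z p : E) :
    ∃ g : ℝ, 0 < g ∧ (1 + g) • F (midpoint ℝ z p) = F z + g • F p := by
  obtain ⟨a, b, ha, hb, hab, h⟩ := hF z p (midpoint_mem_openSegment z p)
  refine ⟨b / a, by positivity, ?_⟩
  have e : 1 + b / a = a⁻¹ := by field_simp; linarith
  rw [← h, e, smul_add, smul_smul, smul_smul, inv_mul_cancel₀ ha.ne', one_smul, div_eq_inv_mul]

section weights

variable {F : E → G} {z : E} {g : E → ℝ}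

/-- The weights relative to `z` govern the midpoint of any two points that form a triangle with
`z` after mapping: this is Ceva's theorem for the images of the medians, which meet in the image
of the centroid. -/
theorem smul_map_midpoint_eq_of_weights
    (hF : ∀ x y, Set.MapsTo F (openSegment ℝ x y) (openSegment ℝ (F x) (F y)))
    (hg : ∀ p, 0 < g p) (hz : ∀ p, (1 + g p) • F (midpoint ℝ z p) = F z + g p • F p)
    {p q : E} (hN : NonCollinearTriple (F z) (F p) (F q)) :
    (g p + g q) • F (midpoint ℝ p q) = g p • F p + g q • F q := by
  set c : E := (1 / 3 : ℝ) • (z + p + q) with hc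
  have hmem : ∀ {x y w : E}, x + y + w = z + p + q → c ∈ openSegment ℝ (midpoint ℝ x y) w := by
    intro x y w h
    refine ⟨2 / 3, 1 / 3, by norm_num, by norm_num, by norm_num, ?_⟩
    rw [hc, ← h, midpoint_eq_smul_add, invOf_eq_inv]
    module
  obtain ⟨s₁, t₁, hs₁, ht₁, hst₁, h₁⟩ := hF _ _ (hmem (x := z) (y := p) (w := q) rfl)
  obtain ⟨s₂, t₂, hs₂, ht₂, hst₂, h₂⟩ := hF _ _ (hmem (x := z) (y := q) (w := p) (by abel))
  obtain ⟨s₃, t₃, hs₃, ht₃, hst₃, h₃⟩ := hF _ _ (hmem (x := p) (y := q) (w := z) (by abel))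
  obtain ⟨a, b, ha, hb, hab, hm⟩ := hF p q (midpoint_mem_openSegment p q)
  have hp := hg p
  have hq := hg q
  obtain ⟨k₁, rfl⟩ : ∃ k, s₁ = k * (1 + g p) := ⟨s₁ / (1 + g p), by field_simp⟩
  obtain ⟨k₂, rfl⟩ : ∃ k, s₂ = k * (1 + g q) := ⟨s₂ / (1 + g q), by field_simp⟩
  have e₁ : F c = k₁ • F z + (k₁ * g p) • F p + t₁ • F q := by
    linear_combination (norm := module) -h₁ + k₁ • hz p
  have e₂ : F c = k₂ • F z + t₂ • F p + (k₂ * g q) • F q := by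
    linear_combination (norm := module) -h₂ + k₂ • hz q
  have e₃ : F c = t₃ • F z + (s₃ * a) • F p + (s₃ * b) • F q := by
    linear_combination (norm := module) -h₃ - s₃ • hm
  obtain ⟨i₁, i₂, i₃⟩ := hN.coeff_eq (by linear_combination hst₁ - hst₂) (e₁.symm.trans e₂)
  obtain ⟨j₁, j₂, j₃⟩ := hN.coeff_eq (by linear_combination hst₁ - hst₃ - s₃ * hab)
    (e₁.symm.trans e₃)
  have key : a * g q = b * g p := by
    apply mul_left_cancel₀ hs₃.ne'
    linear_combination g p * j₃ - g q * j₂ - g p * i₃ + g p * g q * i₁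
  have ka : (g p + g q) * a = g p := by linear_combination g p * hab + key
  have kb : (g p + g q) * b = g q := by linear_combination g q * hab - key
  rw [← hm, smul_add, smul_smul, smul_smul, ka, kb]

/-- The weights relative to `z` satisfy Jensen's equation, because
`midpoint z (midpoint p q) = midpoint (midpoint z p) (midpoint z q)`. -/
theorem weight_midpoint
    (hF : ∀ x y, Set.MapsTo F (openSegment ℝ x y) (openSegment ℝ (F x) (F y)))
    (hg : ∀ p, 0 < g p) (hz : ∀ p, (1 + g p) • F (midpoint ℝ z p) = F z + g p • F p)
    {p q : E} (hN : NonCollinearTriple (F z) (F p) (F q)) :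
    2 * g (midpoint ℝ p q) = g p + g q := by
  have hN' : NonCollinearTriple (F z) (F (midpoint ℝ z p)) (F (midpoint ℝ z q)) :=
    hN.of_smul_eq (hg p) (hg q) (hz p) (hz q)
  have hm := smul_map_midpoint_eq_of_weights hF hg hz hN
  have hm' := smul_map_midpoint_eq_of_weights hF hg hz hN'
  have hzm := hz (midpoint ℝ p q)
  have hQ : midpoint ℝ (midpoint ℝ z p) (midpoint ℝ z q) = midpoint ℝ z (midpoint ℝ p q) := by
    simp only [midpoint_eq_smul_add, invOf_eq_inv]
    module
  rw [hQ] at hm'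
  have hp := hg p
  have hq := hg q
  have hgm := hg (midpoint ℝ p q)
  have hu := hg (midpoint ℝ z p)
  have hv := hg (midpoint ℝ z q)
  have hzp := hz p
  have hzq := hz q
  generalize g (midpoint ℝ p q) = m at *
  generalize g (midpoint ℝ z p) = u at *
  generalize g (midpoint ℝ z q) = v at *
  generalize F (midpoint ℝ z (midpoint ℝ p q)) = Q at *
  -- the barycentric coordinates of `Q`, computed in two ways
  have e₁ : Q = (1 / (1 + m)) • F z + (m / (1 + m) / (g p + g q) * g p) • F p
      + (m / (1 + m) / (g p + g q) * g q) • F q := by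
    have h1 : (m / (1 + m) / (g p + g q)) * (g p + g q) = m / (1 + m) := by field_simp
    have h2 : (1 / (1 + m)) * (1 + m) = 1 := by field_simp
    calc Q = ((1 / (1 + m)) * (1 + m)) • Q := by rw [h2, one_smul]
      _ = (1 / (1 + m)) • F z + ((m / (1 + m) / (g p + g q)) * (g p + g q))
          • F (midpoint ℝ p q) := by rw [mul_smul, hzm, h1]; module
      _ = _ := by rw [mul_smul, hm]; module
  have e₂ : Q = (u / (1 + g p) / (u + v) + v / (1 + g q) / (u + v)) • F z
      + (u * g p / (1 + g p) / (u + v)) • F p + (v * g q / (1 + g q) / (u + v)) • F q := by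
    have h1 : (u / (1 + g p) / (u + v)) * (1 + g p) = (1 / (u + v)) * u := by field_simp
    have h2 : (v / (1 + g q) / (u + v)) * (1 + g q) = (1 / (u + v)) * v := by field_simp
    have h3 : (1 / (u + v)) * (u + v) = 1 := by field_simp
    calc Q = ((1 / (u + v)) * (u + v)) • Q := by rw [h3, one_smul]
      _ = ((1 / (u + v)) * u) • F (midpoint ℝ z p)
          + ((1 / (u + v)) * v) • F (midpoint ℝ z q) := by rw [mul_smul, hm']; module
      _ = _ := by rw [← h1, ← h2, mul_smul, mul_smul, hzp, hzq]; module
  obtain ⟨i₁, i₂, i₃⟩ := hN.coeff_eq (by field_simp; ring) (e₁.symm.trans e₂)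
  have j₂ : m / (1 + m) / (g p + g q) = u / (1 + g p) / (u + v) := by
    apply mul_left_cancel₀ hp.ne'
    linear_combination i₂
  have j₃ : m / (1 + m) / (g p + g q) = v / (1 + g q) / (u + v) := by
    apply mul_left_cancel₀ hq.ne'
    linear_combination i₃
  rw [← j₂, ← j₃] at i₁
  field_simp at i₁
  linarith

/-- By Jensen's equation the weights along `p, q, 2 q - p, …` form an arithmetic progression, and
positivity forces its step to be nonnegative. -/
theorem weight_le_weight
    (hF : ∀ x y, Set.MapsTo F (openSegment ℝ x y) (openSegment ℝ (F x) (F y)))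
    (hg : ∀ p, 0 < g p) (hz : ∀ p, (1 + g p) • F (midpoint ℝ z p) = F z + g p • F p)
    {p q : E} (hN : NonCollinearTriple (F z) (F p) (F q)) : g p ≤ g q := by
  set P : ℕ → E := fun n => p + (n : ℝ) • (q - p) with hP
  have hmid : ∀ n, midpoint ℝ (P n) (P (n + 2)) = P (n + 1) := by
    intro n
    simp only [hP, midpoint_eq_smul_add, invOf_eq_inv]
    push_cast
    module
  have hrel : ∀ n, ∃ a b : ℝ, 0 < a ∧ 0 < b ∧ a + b = 1 ∧
      a • F (P n) + b • F (P (n + 2)) = F (P (n + 1)) := by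
    intro n
    obtain ⟨a, b, ha, hb, hab, h⟩ := hF _ _ (midpoint_mem_openSegment (P n) (P (n + 2)))
    exact ⟨a, b, ha, hb, hab, hmid n ▸ h⟩
  -- `F (P (n + 2))` lies on the line through `F (P n)` and `F (P (n + 1))`, strictly beyond the
  -- latter, so the triangle with vertex `F z` never degenerates
  have hcons : ∀ n, NonCollinearTriple (F z) (F (P n)) (F (P (n + 1))) := by
    intro n
    induction n with
    | zero => simpa [hP] using hN
    | succ n ih =>
      obtain ⟨a, b, ha, hb, hab, h⟩ := hrel n
      intro x y w hs he
      obtain ⟨k1, k2, k3⟩ := ih (b * x) (-(w * a)) (b * y + w)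
        (by linear_combination b * hs - w * hab)
        (by linear_combination (norm := module) b • he - w • h)
      have hx := (mul_eq_zero.1 k1).resolve_left hb.ne'
      have hw := (mul_eq_zero.1 (neg_eq_zero.1 k2)).resolve_right ha.ne'
      exact ⟨hx, by linarith, hw⟩
  have htwo : ∀ n, NonCollinearTriple (F z) (F (P n)) (F (P (n + 2))) := by
    intro n
    obtain ⟨a, b, ha, hb, hab, h⟩ := hrel n
    intro x y w hs he
    obtain ⟨k1, k2, k3⟩ := hcons n (b * x) (b * y - w * a) w
      (by linear_combination b * hs - w * hab)
      (by linear_combination (norm := module) b • he - w • h)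
    have hx := (mul_eq_zero.1 k1).resolve_left hb.ne'
    exact ⟨hx, by linarith, k3⟩
  have hstep : ∀ n, g (P (n + 2)) = 2 * g (P (n + 1)) - g (P n) := fun n => by
    have := weight_midpoint hF hg hz (htwo n)
    rw [hmid] at this
    linarith
  have hP0 : P 0 = p := by simp [hP]
  have hP1 : P 1 = q := by simp [hP]
  have harith : ∀ n : ℕ, g (P n) = g p + n * (g q - g p) ∧
      g (P (n + 1)) = g p + (n + 1) * (g q - g p) := by
    intro n
    induction n with
    | zero => simp [hP0, hP1]
    | succ n ih =>
      refine ⟨by rw [ih.2]; push_cast; ring, ?_⟩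
      rw [hstep n, ih.1, ih.2]
      push_cast
      ring
  -- an arithmetic progression of positive numbers cannot decrease
  by_contra! hlt
  obtain ⟨n, hn⟩ := exists_nat_gt (g p / (g p - g q))
  rw [div_lt_iff₀ (by linarith)] at hn
  have := hg (P n)
  rw [(harith n).1] at this
  linarith

end weights

theorem map_midpoint_of_mapsTo_openSegment {F : E → G}
    (hF : ∀ x y, Set.MapsTo F (openSegment ℝ x y) (openSegment ℝ (F x) (F y)))
    (hN : ∀ p q, F p ≠ F q → ∃ z, NonCollinearTriple (F z) (F p) (F q)) (p q : E) :
    F (midpoint ℝ p q) = midpoint ℝ (F p) (F q) := by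
  by_cases hpq : F p = F q
  · have := hF p q (midpoint_mem_openSegment p q)
    rw [hpq, openSegment_same, Set.mem_singleton_iff] at this
    rw [this, hpq, midpoint_self]
  obtain ⟨z, hz⟩ := hN p q hpq
  choose g hg hgz using exists_midpoint_weight hF z
  have hle := weight_le_weight hF hg hgz hz
  have hge := weight_le_weight hF hg hgz hz.swap_right
  have h := smul_map_midpoint_eq_of_weights hF hg hgz hz
  rw [le_antisymm hge hle, ← smul_add, ← two_mul, mul_comm, mul_smul] at h
  have h2 := smul_right_injective G (hg p).ne' h
  rw [midpoint_eq_smul_add ℝ (F p), ← h2, smul_smul, invOf_mul_self, one_smul]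

end

/-- An additive map that preserves open segments is linear, because it is bounded on segments. -/
theorem AddMonoidHom.map_real_smul_of_mapsTo_segment {E G : Type*} [AddCommGroup E] [Module ℝ E]
    [NormedAddCommGroup G] [NormedSpace ℝ G] (A : E →+ G)
    (hA : ∀ x y, Set.MapsTo A (openSegment ℝ x y) (openSegment ℝ (A x) (A y)))
    (t : ℝ) (v : E) : A (t • v) = t • A v := by
  let D : ℝ →+ G :=
    { toFun := fun t => A (t • v) - t • A v
      map_zero' := by simp
      map_add' := fun a b => by simp only [add_smul, map_add]; abel }
  have hD : ∀ t, D t = A (t • v) - t • A v := fun _ => rfl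
  have hD1 : D 1 = 0 := by simp [hD]
  -- `D` has period `1` and is bounded on `[0, 1)`, hence bounded
  have hfr : ∀ t, ‖D t‖ ≤ 2 * ‖A v‖ := by
    intro t
    have h1 : D t = D (Int.fract t) := by
      conv_lhs => rw [← Int.floor_add_fract t]
      have : D ((⌊t⌋ : ℤ) : ℝ) = 0 := by
        have := map_zsmul D ⌊t⌋ 1
        rw [hD1, smul_zero, zsmul_one] at this
        exact this
      rw [map_add, this, zero_add]
    rw [h1, hD]
    have h0 := Int.fract_nonneg t
    have hlt := Int.fract_lt_one t
    generalize Int.fract t = s at *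
    have hs : ‖A (s • v)‖ ≤ ‖A v‖ := by
      rcases h0.eq_or_lt with rfl | h0
      · simp
      obtain ⟨a, b, ha, hb, hab, h⟩ := @hA 0 v (s • v) ⟨1 - s, s, by linarith, h0, by ring,
        by simp⟩
      rw [map_zero, smul_zero, zero_add] at h
      rw [← h, norm_smul, Real.norm_of_nonneg hb.le]
      nlinarith [norm_nonneg (A v)]
    have hs' : ‖s • A v‖ ≤ ‖A v‖ := by
      rw [norm_smul, Real.norm_of_nonneg h0]
      nlinarith [norm_nonneg (A v)]
    linarith [norm_sub_le (A (s • v)) (s • A v)]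
  -- a bounded additive map vanishes
  have h0 : D t = 0 := by
    by_contra hne
    have hpos := norm_pos_iff.2 hne
    obtain ⟨n, hn⟩ := exists_nat_gt (2 * ‖A v‖ / ‖D t‖)
    rw [div_lt_iff₀ hpos] at hn
    have := hfr (n • t)
    rw [map_nsmul, ← Nat.cast_smul_eq_nsmul ℝ, norm_smul, Real.norm_natCast] at this
    linarith
  exact sub_eq_zero.1 h0

/-- Fundamental theorem for maps preserving open segments: if the range is not contained in a
line, such a map is affine. -/
theorem exists_linearMap_of_mapsTo_openSegment {E G : Type*} [AddCommGroup E] [Module ℝ E]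
    [NormedAddCommGroup G] [NormedSpace ℝ G] {F : E → G}
    (hF : ∀ x y, Set.MapsTo F (openSegment ℝ x y) (openSegment ℝ (F x) (F y)))
    (hN : ∀ p q, F p ≠ F q → ∃ z, NonCollinearTriple (F z) (F p) (F q)) :
    ∃ A : E →ₗ[ℝ] G, ∀ x, F x = F 0 + A x := by
  have hmid := map_midpoint_of_mapsTo_openSegment hF hN
  have hhalf : ∀ x, (2 : ℝ) • F ((1 / 2 : ℝ) • x) = F x + F 0 := by
    intro x
    have := hmid x 0
    simp only [midpoint_eq_smul_add, invOf_eq_inv, add_zero] at this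
    rw [one_div, this, smul_smul]
    norm_num
  let A : E →+ G :=
    { toFun := fun x => F x - F 0
      map_zero' := sub_self _
      map_add' := fun x y => by
        have h1 := hmid x y
        have h2 := hhalf (x + y)
        simp only [midpoint_eq_smul_add, invOf_eq_inv] at h1
        rw [one_div, h1, smul_smul] at h2
        norm_num at h2
        rw [eq_sub_of_add_eq h2.symm]
        abel }
  have hA : ∀ x, A x = F x - F 0 := fun _ => rfl
  have hseg : ∀ x y, Set.MapsTo A (openSegment ℝ x y) (openSegment ℝ (A x) (A y)) := by
    intro x y w hw
    obtain ⟨a, b, ha, hb, hab, h⟩ := hF x y hw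
    refine ⟨a, b, ha, hb, hab, ?_⟩
    rw [hA, hA, hA, ← h]
    linear_combination (norm := module) -hab • F 0
  exact ⟨{ A with map_smul' := A.map_real_smul_of_mapsTo_segment hseg },
    fun x => (add_sub_cancel (F 0) (F x)).symm⟩

/-! ### The affine chart of the perspective function -/

section

variable {d d' : ℕ}

/-- The linear map `(s⁰, …, s^d) ↦ (s¹, …, s^d)`. -/
def tailMap (d : ℕ) : Vec (d + 1) →ₗ[ℝ] Vec d where
  toFun s := WithLp.toLp 2 fun j => s j.succ
  map_add' _ _ := rfl
  map_smul' _ _ := rfl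

/-- The linear embedding `(c, x) ↦ (c, x¹, …, x^d)`. -/
def consMap (d : ℕ) : ℝ × Vec d →ₗ[ℝ] Vec (d + 1) where
  toFun p := WithLp.toLp 2 (Fin.cons p.1 p.2)
  map_add' p q := by
    ext i
    refine Fin.cases ?_ (fun j => ?_) i <;> simp
  map_smul' c p := by
    ext i
    refine Fin.cases ?_ (fun j => ?_) i <;> simp

@[simp]
theorem tailMap_apply (s : Vec (d + 1)) (j : Fin d) : tailMap d s j = s j.succ := rfl

@[simp]
theorem consMap_zero (p : ℝ × Vec d) : consMap d p 0 = p.1 := rfl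

@[simp]
theorem consMap_succ (p : ℝ × Vec d) (j : Fin d) : consMap d p j.succ = p.2 j := rfl

theorem persp_eq_smul (s : Vec (d + 1)) : persp s = (s 0)⁻¹ • tailMap d s := by
  ext j
  simp [persp, div_eq_inv_mul]

theorem persp_smul {c : ℝ} (hc : c ≠ 0) (s : Vec (d + 1)) : persp (c • s) = persp s := by
  ext j
  simp [persp, mul_div_mul_left _ _ hc]

/-- The section `x ↦ (1, x)` of the perspective function. -/
def perspSection (x : Vec d) : PerspDom d := ⟨consMap d (1, x), by simp⟩

@[simp]
theorem persp_perspSection (x : Vec d) : persp (perspSection x).1 = x := by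
  ext j
  simp [persp, perspSection]

theorem scale_perspSection_persp (s : PerspDom d) :
    (perspSection (persp s.1)).scale (s.1 0) s.2 = s := by
  have := s.2.ne'
  apply Subtype.ext
  ext i
  refine Fin.cases ?_ (fun j => ?_) i
  · simp [PerspDom.scale, perspSection]
  · simp [PerspDom.scale, perspSection, persp]
    field_simp

theorem smul_perspSection_persp (s : PerspDom d) :
    s.1 0 • (perspSection (persp s.1)).1 = s.1 :=
  congrArg Subtype.val (scale_perspSection_persp s)

/-- The map of relative prices induced by a map of prices that satisfies the scaling
condition. -/
noncomputable def relativeMap (f : PerspDom d → PerspDom d') (x : Vec d) : Vec d' :=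
  persp (f (perspSection x)).1

theorem persp_map_eq_relativeMap {f : PerspDom d → PerspDom d'}
    (hf : ScalarCondition (fun s => (f s).1)) (s : PerspDom d) :
    persp (f s).1 = relativeMap f (persp s.1) := by
  obtain ⟨μ, hμ, h⟩ := hf (s.1 0) s.2 (perspSection (persp s.1))
  simp only [scale_perspSection_persp] at h
  rw [h, persp_smul hμ.ne', relativeMap]

/-! ### One-step markets -/

/-- The trajectory that starts at `x`, moves to `s` and stays there. -/
def oneStepPath (x s : PerspDom d) : Trajectory d (fun _ => PUnit.{u + 1}) where
  price i := if i = 0 then x.1 else s.1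
  obs _ := PUnit.unit
  stage := 1

/-- The market of all one-step trajectories from `x` to a point of `A`, without any trading. -/
def oneStepMarket (x : PerspDom d) (A : Set (PerspDom d)) : Market.{u} d where
  Ω _ := PUnit.{u + 1}
  Sig _ := Set.univ
  Θ := Set.univ
  s₀ := x.1
  w₀ := PUnit.unit
  paths := oneStepPath x '' A
  paths_subset := by
    rintro _ ⟨s, -, rfl⟩
    exact ⟨fun _ => trivial, trivial, rfl, rfl⟩
  price_pos := by
    rintro ⟨_, s, hs, rfl⟩ i
    by_cases hi : i = 0
    · simpa [oneStepPath, hi] using x.2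
    · simpa [oneStepPath, hi] using s.2
  portfolios := {Portfolio.null _}
  selfFinancing := by
    rintro _ rfl S i
    simp [Portfolio.value, Portfolio.null]
  null_mem := rfl
  liquidated := by
    rintro _ rfl S
    exact ⟨0, fun _ _ => ⟨rfl, rfl⟩⟩

theorem oneStepMarket_conditioned_zero (x : PerspDom d) (A : Set (PerspDom d))
    (S : (oneStepMarket.{u} x A).paths) : (oneStepMarket.{u} x A).conditioned S 0 = Set.univ := by
  obtain ⟨_, s, hs, rfl⟩ := S
  refine Set.eq_univ_of_forall ?_
  rintro ⟨_, s', hs', rfl⟩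
  refine ⟨fun i hi => ?_, Nat.zero_lt_one⟩
  obtain rfl : i = 0 := by omega
  rfl

theorem oneStepMarket_conditioned_succ (x : PerspDom d) (A : Set (PerspDom d))
    (S : (oneStepMarket.{u} x A).paths) (k : ℕ) :
    (oneStepMarket.{u} x A).conditioned S (k + 1) = ∅ := by
  refine Set.eq_empty_of_forall_notMem ?_
  rintro ⟨_, s', hs', rfl⟩ ⟨-, h⟩
  exact absurd (show k + 1 < 1 from h) (by omega)

theorem oneStepMarket_increments (x : PerspDom d) (A : Set (PerspDom d))
    (S : (oneStepMarket.{u} x A).paths) :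
    (oneStepMarket.{u} x A).increments S 0 = (fun s => persp s.1 - persp x.1) '' A := by
  rw [Market.increments, oneStepMarket_conditioned_zero]
  ext v
  constructor
  · rintro ⟨⟨_, s, hs, rfl⟩, -, rfl⟩
    exact ⟨s, hs, rfl⟩
  · rintro ⟨s, hs, rfl⟩
    exact ⟨⟨_, s, hs, rfl⟩, trivial, rfl⟩

/-- The trajectory from `f x` to `f s`, for a one-step trajectory from `x` to `s`. -/
def oneStepTransform (f : PerspDom d → PerspDom d') (x : PerspDom d) (A : Set (PerspDom d))
    (S : (oneStepMarket.{u} x A).paths) : (oneStepMarket.{u} (f x) (f '' A)).paths :=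
  ⟨oneStepPath (f x) (f ((oneStepMarket.{u} x A).pricePt S 1)), by
    obtain ⟨_, s, hs, rfl⟩ := S
    exact ⟨_, ⟨s, hs, rfl⟩, rfl⟩⟩

theorem isTransformation_oneStepTransform (f : PerspDom d → PerspDom d') (x : PerspDom d)
    (A : Set (PerspDom d)) :
    IsTransformation f (oneStepMarket.{u} x A) (oneStepMarket.{u} (f x) (f '' A))
      (oneStepTransform f x A) := by
  have honto : Function.Surjective (oneStepTransform.{u} f x A) := by
    rintro ⟨_, _, ⟨s, hs, rfl⟩, rfl⟩
    exact ⟨⟨_, s, hs, rfl⟩, rfl⟩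
  refine ⟨honto, ?_, ?_⟩
  · rintro ⟨_, s, hs, rfl⟩ k
    cases k <;> rfl
  · rintro S k
    cases k with
    | zero => rw [oneStepMarket_conditioned_zero, oneStepMarket_conditioned_zero,
        Set.image_univ, honto.range_eq]
    | succ k => rw [oneStepMarket_conditioned_succ, oneStepMarket_conditioned_succ,
        Set.image_empty]

theorem zero_mem_openSegment_sub_iff {E : Type*} [AddCommGroup E] [Module ℝ E] {a b x : E} :
    (0 : E) ∈ openSegment ℝ (a - x) (b - x) ↔ x ∈ openSegment ℝ a b := by
  rw [← mem_openSegment_translate ℝ x, add_zero, add_sub_cancel, add_sub_cancel]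

/-- Applied to one-step markets with two trajectories, the symmetry property says that the
induced map of relative prices preserves open segments. -/
theorem IsNoArbitrageSymmetry.mapsTo_openSegment {f : PerspDom d → PerspDom d'}
    (h : IsNoArbitrageSymmetry.{u} f) (a b : Vec d) :
    Set.MapsTo (relativeMap f) (openSegment ℝ a b)
      (openSegment ℝ (relativeMap f a) (relativeMap f b)) := by
  intro x hx
  -- for two trajectories, the initial node is arbitrage-free iff `x ∈ openSegment ℝ a b`
  let S : (oneStepMarket.{u} (perspSection x) {perspSection a, perspSection b}).paths :=
    ⟨_, perspSection a, Set.mem_insert _ _, rfl⟩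
  have key := h _ _ _ (isTransformation_oneStepTransform.{u} f (perspSection x)
    {perspSection a, perspSection b}) S 0
  unfold Market.ArbitrageFreeNode at key
  rw [oneStepMarket_increments, oneStepMarket_increments, Set.image_pair, Set.image_pair,
    Set.image_pair, convexHull_pair, convexHull_pair, zero_mem_intrinsicInterior_segment_iff,
    zero_mem_intrinsicInterior_segment_iff, zero_mem_openSegment_sub_iff,
    zero_mem_openSegment_sub_iff] at key
  simp only [persp_perspSection] at key
  exact key hx

/-! ### Fractional forms -/

/-- If the relative prices of the range of `f` were on a line, the range would be contained in
the plane spanned by the corresponding points with first coordinate `1`. -/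
theorem exists_nonCollinearTriple_relativeMap {f : PerspDom d → PerspDom d'}
    (hf : ScalarCondition (fun s => (f s).1))
    (hP : ¬ ∃ P : Submodule ℝ (Vec (d' + 1)), Module.finrank ℝ P = 2 ∧ ∀ s, (f s).1 ∈ P)
    (p q : Vec d) (hpq : relativeMap f p ≠ relativeMap f q) :
    ∃ z, NonCollinearTriple (relativeMap f z) (relativeMap f p) (relativeMap f q) := by
  by_contra! hN
  generalize hX : relativeMap f p = X at *
  generalize hY : relativeMap f q = Y at *
  have hli : LinearIndependent ℝ ![consMap d' (1, X), consMap d' (1, Y)] := by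
    rw [LinearIndependent.pair_iff]
    intro a b hab
    have h0 := congrArg (fun v : Vec (d' + 1) => v 0) hab
    have h1 := congrArg (tailMap d') hab
    have ht : ∀ x : Vec d', tailMap d' (consMap d' (1, x)) = x := fun _ => rfl
    simp only [map_add, map_smul, ht, map_zero] at h1
    simp at h0
    obtain rfl : b = -a := by linarith
    have h2 : a • (X - Y) = 0 := by rw [← h1]; module
    have ha := (smul_eq_zero.1 h2).resolve_right (sub_ne_zero.2 hpq)
    simp [ha]
  refine hP ⟨_, (finrank_span_eq_card hli).trans (Fintype.card_fin 2), fun s => ?_⟩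
  have hu : consMap d' (1, X) ∈ Submodule.span ℝ
      (Set.range ![consMap d' (1, X), consMap d' (1, Y)]) := Submodule.subset_span ⟨0, rfl⟩
  have hv : consMap d' (1, Y) ∈ Submodule.span ℝ
      (Set.range ![consMap d' (1, X), consMap d' (1, Y)]) := Submodule.subset_span ⟨1, rfl⟩
  have hz := hN (persp s.1)
  rw [← persp_map_eq_relativeMap hf] at hz
  unfold NonCollinearTriple at hz
  push Not at hz
  obtain ⟨a, b, c, hs, he, hne⟩ := hz
  have ha : a ≠ 0 := by
    rintro rfl
    obtain rfl : c = -b := by linarith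
    have h2 : b • (X - Y) = 0 := by rw [← he]; module
    have hb := (smul_eq_zero.1 h2).resolve_right (sub_ne_zero.2 hpq)
    exact hne rfl hb (by simp [hb])
  have hrel : a • consMap d' (1, persp (f s).1) + b • consMap d' (1, X)
      + c • consMap d' (1, Y) = 0 := by
    rw [← map_smul, ← map_smul, ← map_smul, ← map_add, ← map_add, ← map_zero (consMap d')]
    congr 1
    ext1
    · simpa using hs
    · exact he
  have hmem : consMap d' (1, persp (f s).1) = a⁻¹ • (-(b • consMap d' (1, X))
      - c • consMap d' (1, Y)) := by
    rw [eq_inv_smul_iff₀ ha]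
    linear_combination (norm := module) hrel
  rw [← smul_perspSection_persp (f s)]
  refine Submodule.smul_mem _ _ ?_
  change consMap d' (1, persp (f s).1) ∈ _
  rw [hmem]
  exact Submodule.smul_mem _ _ (Submodule.sub_mem _ (Submodule.neg_mem _
    (Submodule.smul_mem _ _ hu)) (Submodule.smul_mem _ _ hv))

theorem hasFractionalForm_of_relativeMap_eq {f : PerspDom d → PerspDom d'}
    (hf : ScalarCondition (fun s => (f s).1)) (A : Vec d →ₗ[ℝ] Vec d')
    (hA : ∀ x, relativeMap f x = relativeMap f 0 + A x) : HasFractionalForm f := by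
  refine ⟨fun c hc s => ?_, ?_⟩
  · obtain ⟨μ, hμ, h⟩ := hf c hc s
    exact ⟨μ, hμ, congrArg (fun v : Vec (d' + 1) => v 0) h⟩
  -- `L s = (s⁰, s⁰ b + A (s¹, …, s^d))`, where `b + A` is the map of relative prices
  let π : Vec (d + 1) →ₗ[ℝ] ℝ := (EuclideanSpace.proj (0 : Fin (d + 1))).toLinearMap
  let L : Vec (d + 1) →ₗ[ℝ] Vec (d' + 1) :=
    consMap d' ∘ₗ π.prod (π.smulRight (relativeMap f 0) + A ∘ₗ tailMap d)
  have hL : ∀ s, L s = consMap d' (s 0, s 0 • relativeMap f 0 + A (tailMap d s)) := fun _ => rfl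
  refine ⟨L, fun s => ⟨(f s).2, s.2⟩, fun s => ?_⟩
  have hs := s.2.ne'
  have h1 : L s.1 = s.1 0 • consMap d' (1, persp (f s).1) := by
    rw [hL, persp_map_eq_relativeMap hf, hA (persp s.1), persp_eq_smul, map_smul, ← map_smul]
    congr 1
    ext1
    · simp
    · simp [smul_smul, mul_inv_cancel₀ hs]
  have h0 : L s.1 0 = s.1 0 := rfl
  rw [h0, h1, smul_smul, div_mul_cancel₀ _ hs]
  exact (smul_perspSection_persp (f s)).symm

theorem LinearMap.eq_zero_of_forall_add_pos {E : Type*} [AddCommGroup E] [Module ℝ E]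
    (φ : E →ₗ[ℝ] ℝ) (c : ℝ) (h : ∀ x, 0 < c + φ x) (x : E) : φ x = 0 := by
  by_contra hne
  have := h ((-c / φ x) • x)
  rw [map_smul, smul_eq_mul, div_mul_cancel₀ _ hne] at this
  linarith

/-- A map of fractional form acts on differences of relative prices by a linear map, since a
linear form that is positive on `{s⁰ > 0}` is a multiple of `s⁰`. -/
theorem HasFractionalForm.exists_linearMap {f : PerspDom d → PerspDom d'}
    (h : HasFractionalForm f) : ∃ A : Vec d →ₗ[ℝ] Vec d', ∀ s t : PerspDom d,
      persp (f s).1 - persp (f t).1 = A (persp s.1 - persp t.1) := by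
  obtain ⟨-, L, hpos, hL⟩ := h
  let B : Vec d →ₗ[ℝ] Vec (d' + 1) := L ∘ₗ consMap d ∘ₗ LinearMap.inr ℝ ℝ (Vec d)
  have hB : ∀ x, L (perspSection x).1 = L (consMap d (1, 0)) + B x := by
    intro x
    change L (consMap d (1, x)) = L (consMap d (1, 0)) + L (consMap d (0, x))
    rw [← map_add, ← map_add, Prod.mk_add_mk, add_zero, zero_add]
  let c := L (consMap d (1, 0)) 0
  have hB0 : ∀ x, B x 0 = 0 := by
    refine LinearMap.eq_zero_of_forall_add_pos
      ((EuclideanSpace.proj (0 : Fin (d' + 1))).toLinearMap ∘ₗ B) c fun x => ?_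
    have := (hpos (perspSection x)).2
    rw [hB] at this
    exact this
  have key : ∀ s, persp (f s).1 =
      c⁻¹ • tailMap d' (L (consMap d (1, 0))) + c⁻¹ • tailMap d' (B (persp s.1)) := by
    intro s
    have hne : (f s).1 0 / L s.1 0 ≠ 0 := (div_pos (hpos s).1 (hpos s).2).ne'
    have hLs : L s.1 = s.1 0 • L (perspSection (persp s.1)).1 := by
      rw [← map_smul, smul_perspSection_persp]
    have hc : L (perspSection (persp s.1)).1 0 = c := by
      rw [hB, PiLp.add_apply, hB0, add_zero]
    rw [hL s, persp_smul hne, hLs, persp_smul s.2.ne', persp_eq_smul, hc, hB, map_add, smul_add]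
  refine ⟨c⁻¹ • (tailMap d' ∘ₗ B), fun s t => ?_⟩
  rw [key s, key t, add_sub_add_left_eq_sub, ← smul_sub, ← map_sub (tailMap d'), ← map_sub B]
  rfl

theorem HasFractionalForm.isNoArbitrageSymmetry {f : PerspDom d → PerspDom d'}
    (h : HasFractionalForm f) : IsNoArbitrageSymmetry.{u} f := by
  obtain ⟨A, hA⟩ := h.exists_linearMap
  intro M M' T hT S k hS
  have hinc : M'.increments (T S) k = A '' M.increments S k := by
    unfold Market.increments
    rw [hT.node_eq, Set.image_image, Set.image_image]
    refine Set.image_congr fun S' _ => ?_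
    have hp : ∀ i, (T S').1.price i = (f (M.pricePt S' i)).1 := fun i =>
      congrArg Subtype.val (hT.price_eq S' i)
    rw [hp, hp, hA]
    rfl
  unfold Market.ArbitrageFreeNode at hS ⊢
  rw [hinc]
  exact zero_mem_intrinsicInterior_convexHull_image A hS

end

theorem mainTheorem1 {d d' : ℕ} (f : PerspDom d → PerspDom d')
    (hf : ScalarCondition (fun s => (f s).1)) :
    (IsNoArbitrageSymmetry.{u} f →
      (¬ ∃ P : Submodule ℝ (Vec (d' + 1)), Module.finrank ℝ P = 2 ∧ ∀ s, (f s).1 ∈ P) →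
      HasFractionalForm f) ∧
    (HasFractionalForm f → IsNoArbitrageSymmetry.{u} f) := by
  refine ⟨fun h hP => ?_, HasFractionalForm.isNoArbitrageSymmetry⟩
  obtain ⟨A, hA⟩ := exists_linearMap_of_mapsTo_openSegment h.mapsTo_openSegment
    (exists_nonCollinearTriple_relativeMap hf hP)
  exact hasFractionalForm_of_relativeMap_eq hf A hA
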